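/- A curve is a continuous map from a compact interval. Say that a subset $A$ of a topological space $Z$ \emph{disconnects} $z, z' \in Z$ if every curve in $Z$ from $z$ to $z'$ meets $A$. (If $z, z' \notin A$, this means that $z$ and $z'$ lie in different path components of $Z \setminus A$.) (1) Let $Z$ be a connected and locally path connected topological space whose first singular homology group with integer coefficients vanishes, $H_1(Z) = 0$. If a closed set $A \subset Z$ disconnects $z$ and $z'$, then some connected component of $A$ disconnects $z$ and $z'$. (2) Let $Z$ be a connected metric space that is locally Lipschitz path connected, i.e. every point has arbitrarily small neighborhoods $V$ in which any two points are joined by a Lipschitz curve contained in $V$. Assume that the first singular Lipschitz homology group vanishes, $H_1^{\mathrm{Lip}}(Z) = 0$; this is the homology of the complex of integral chains of Lipschitz maps from standard simplices to $Z$. If a closed set $A \subset Z$ disconnects $z$ and $z'$, then some connected component of $A$ disconnects $z$ and $z'$. -/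

import Mathlib

open Topology CategoryTheory

universe u

/-- A set `A` disconnects `z` and `z'` if every curve from `z` to `z'` meets `A`. -/
def Disconnects {Z : Type*} [TopologicalSpace Z] (A : Set Z) (z z' : Z) : Prop :=
  ∀ γ : Path z z', ∃ t, γ t ∈ A

/-- A nonempty set any two points of which are joined by a Lipschitz curve inside the set. -/
def IsLipschitzPathConnected {Z : Type*} [MetricSpace Z] (S : Set Z) : Prop :=
  S.Nonempty ∧ ∀ x ∈ S, ∀ y ∈ S, ∃ (γ : Path x y) (K : NNReal),
    LipschitzWith K γ ∧ ∀ t, γ t ∈ S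

/-- Every point has arbitrarily small Lipschitz path connected neighborhoods. This is the analogue
of `LocallyPathConnectedSpace` for Lipschitz curves. -/
def IsLocallyLipschitzPathConnected (Z : Type*) [MetricSpace Z] : Prop :=
  ∀ x : Z, (𝓝 x).HasBasis (fun S : Set Z => S ∈ 𝓝 x ∧ IsLipschitzPathConnected S) id

/-- The affine map between standard simplices induced by a map of the vertices is Lipschitz. -/
lemma stdSimplex_map_lipschitz {m n : ℕ} (f : Fin m → Fin n) :
    ∃ K : NNReal, LipschitzWith K (stdSimplex.map (S := ℝ) f) := by
  refine ⟨‖(FunOnFinite.linearMap ℝ ℝ f).toContinuousLinearMap‖₊, ?_⟩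
  intro x y
  exact (FunOnFinite.linearMap ℝ ℝ f).toContinuousLinearMap.lipschitz (x : Fin m → ℝ) y

/-- The simplicial set of Lipschitz singular simplices of a metric space `Z`: its `n`-simplices are
the Lipschitz maps from the standard `n`-simplex to `Z`, as a subcomplex of the singular simplicial
set of `Z`. (The simplex carries the restriction of the sup metric of `ℝⁿ⁺¹`, which is Lipschitz
equivalent to the Euclidean one.) -/
noncomputable def lipschitzSingularSet (Z : Type u) [MetricSpace Z] :
    (TopCat.toSSet.obj (TopCat.of Z)).Subcomplex where
  obj n := {s | ∃ K : NNReal,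
    LipschitzWith K (fun p => ((TopCat.of Z).toSSetObjEquiv n s p : Z))}
  map := by
    rintro n m i s ⟨K, hK⟩
    obtain ⟨L, hL⟩ := stdSimplex_map_lipschitz (SimplexCategory.Hom.toOrderHom i.unop)
    exact ⟨K * L, hK.comp hL⟩

/-- The singular homology group `H_n(Z)` with integer coefficients (`ℤ` is lifted to the universe
of `Z`). -/
noncomputable abbrev singularH (n : ℕ) (Z : Type u) [TopologicalSpace Z] : AddCommGrpCat.{u} :=
  ((AlgebraicTopology.singularHomologyFunctor AddCommGrpCat.{u} n).obj
    (AddCommGrpCat.of (ULift.{u} ℤ))).obj (TopCat.of Z)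

/-- The singular Lipschitz homology group `H_n^Lip(Z)` with integer coefficients: the homology of
the complex of integral chains of Lipschitz singular simplices. -/
noncomputable abbrev lipschitzH (n : ℕ) (Z : Type u) [MetricSpace Z] : AddCommGrpCat.{u} :=
  (lipschitzSingularSet Z).toSSet.homology (AddCommGrpCat.of (ULift.{u} ℤ)) n

/-! The proof reduces to unicoherence: two closed connected sets covering `Z` meet in a connected
set. Given this and `z, z' ∉ A`, let `U` be the component of `Aᶜ` at `z`, and `V` the component of
`(closure U)ᶜ` at `z'`. Then `closure V` and `Vᶜ` are connected, so their intersection `frontier V`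
is connected; it lies in `A`, and every curve from `z` to `z'` crosses it
(`exists_disconnects_connectedComponentIn`).

Unicoherence follows from `H₁ = 0` (`isPreconnected_inter_of_isZero_homology`). If `C ∩ D` splits
into disjoint nonempty closed sets `B₁` and `B₂`, gluing copies of `C` and `D` gives a ℤ-covering
that changes level through `B₂`. The level change along edges is a 1-cocycle, so it has a potential.
Read in `C`, the potential takes equal values on `B₁` and `B₂`; read in `D`, these values differ by
1.

Sections of the covering are built only over simplices, since `Z` need not be normal. The argument
works for any simplicial set of singular simplices with enough edges, which handles singular and
Lipschitz homology together. -/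

open Classical in
/-- The label of a point, read in `C` where possible. -/
noncomputable def label {T : Type*} (C : Set T) (F G : T → ℤ) (t : T) : ℤ := C.piecewise F G t

lemma label_of_mem {T : Type*} {C : Set T} {F G : T → ℤ} {t : T} (h : t ∈ C) : label C F G t = F t := by
  simp [label, h]

lemma label_of_notMem {T : Type*} {C : Set T} {F G : T → ℤ} {t : T} (h : t ∉ C) : label C F G t = G t := by
  simp [label, h]

lemma label_comp {T T' : Type*} (C : Set T) (F G : T → ℤ) (f : T' → T)
    (t : T') : label (f ⁻¹' C) (F ∘ f) (G ∘ f) t = label C F G (f t) := by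
  by_cases h : f t ∈ C
  · rw [label_of_mem h, label_of_mem (show t ∈ f ⁻¹' C from h), Function.comp]
  · rw [label_of_notMem h, label_of_notMem (show t ∉ f ⁻¹' C from h), Function.comp]

/-! ### Sections of the ℤ-covering -/

section Labelling

variable {T : Type*} [TopologicalSpace T]

/-- Integer labels `F` on `C` and `G` on `D`, locally constant, that agree on `B₁` and differ by `1`
on `B₂`. If `C` and `D` are closed sets covering the space which meet in `B₁ ∪ B₂`, this is a section
of the `ℤ`-covering which jumps when passing from `C` to `D` through `B₂`. -/
structure IsLabelling (C D B₁ B₂ : Set T) (F G : T → ℤ) : Prop where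
  left : ContinuousOn F C
  right : ContinuousOn G D
  eq₁ : ∀ t ∈ B₁, F t = G t
  eq₂ : ∀ t ∈ B₂, F t = G t + 1

lemma IsLabelling.comp {T' : Type*} [TopologicalSpace T'] {C D B₁ B₂ : Set T} {F G : T → ℤ}
    (h : IsLabelling C D B₁ B₂ F G) {f : T' → T} (hf : Continuous f) :
    IsLabelling (f ⁻¹' C) (f ⁻¹' D) (f ⁻¹' B₁) (f ⁻¹' B₂) (F ∘ f) (G ∘ f) where
  left := h.left.comp hf.continuousOn fun _ ht => ht
  right := h.right.comp hf.continuousOn fun _ ht => ht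
  eq₁ _ ht := h.eq₁ _ ht
  eq₂ _ ht := h.eq₂ _ ht

/-- Two labellings of a connected space differ by a constant. -/
lemma IsLabelling.label_sub_label [PreconnectedSpace T] {C D B₁ B₂ : Set T}
    (hC : IsClosed C) (hD : IsClosed D) (hCD : C ∪ D = Set.univ) (hB : C ∩ D ⊆ B₁ ∪ B₂)
    {F G F' G' : T → ℤ} (h : IsLabelling C D B₁ B₂ F G) (h' : IsLabelling C D B₁ B₂ F' G')
    (s t : T) :
    label C F G t - label C F G s = label C F' G' t - label C F' G' s := by
  set d : T → ℤ := fun t => label C F G t - label C F' G' t with hd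
  have h₁ : Set.EqOn d (fun t => F t - F' t) C := fun t ht => by
    simp only [hd, label_of_mem ht]
  have h₂ : Set.EqOn d (fun t => G t - G' t) D := fun t ht => by
    by_cases hc : t ∈ C
    · rw [h₁ hc]
      rcases hB ⟨hc, ht⟩ with hb | hb
      · simp only [h.eq₁ t hb, h'.eq₁ t hb]
      · simp only [h.eq₂ t hb, h'.eq₂ t hb]; ring
    · simp only [hd, label_of_notMem hc]
  have hcont : Continuous d := by
    rw [← continuousOn_univ, ← hCD]
    exact ((h.left.sub h'.left).congr h₁).union_of_isClosed ((h.right.sub h'.right).congr h₂) hC hD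
  have := PreconnectedSpace.constant inferInstance hcont (x := s) (y := t)
  simp only [hd] at this
  linarith

lemma continuousOn_round_of_mem_range_intCast {s : Set T} {f : T → ℝ} (hf : ContinuousOn f s)
    (h : ∀ t ∈ s, (round (f t) : ℝ) = f t) : ContinuousOn (fun t => round (f t)) s := by
  rw [Int.isClosedEmbedding_coe_real.isInducing.continuousOn_iff]
  exact hf.congr h

/-- Labellings exist over simply connected spaces. -/
lemma exists_isLabelling [SimplyConnectedSpace T] [LocallyPathConnectedSpace T] [NormalSpace T]
    {C D B₁ B₂ : Set T} (hC : IsClosed C) (hD : IsClosed D) (hCD : C ∪ D = Set.univ)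
    (hB : C ∩ D = B₁ ∪ B₂) (hB₁ : IsClosed B₁) (hB₂ : IsClosed B₂) (hd : Disjoint B₁ B₂) :
    ∃ F G : T → ℤ, IsLabelling C D B₁ B₂ F G := by
  classical
  obtain ⟨u, hu₁, hu₂, -⟩ := exists_continuous_zero_one_of_isClosed hB₁ hB₂ hd
  -- The Urysohn function wraps `D` around the circle from `B₁` to `B₂`, while `C` goes to the base
  -- point. A real lift `Θ` is integral on `C`, and `Θ - u` is integral on `D`; these are the two
  -- labels.
  let θ : T → AddCircle (1 : ℝ) := C.piecewise 0 fun t => (u t : AddCircle (1 : ℝ))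
  have hθC : Set.EqOn θ 0 C := fun t ht => by simp [θ, ht]
  have hθD : Set.EqOn θ (fun t => (u t : AddCircle (1 : ℝ))) D := fun t ht => by
    by_cases hc : t ∈ C
    · rw [hθC hc]
      have hb : t ∈ B₁ ∪ B₂ := hB ▸ ⟨hc, ht⟩
      rcases hb with hb | hb
      · simp [hu₁ hb]
      · have : u t = 1 := hu₂ hb
        simp [this, AddCircle.coe_period]
    · simp [θ, hc]
  have hθ : Continuous θ := by
    rw [← continuousOn_univ, ← hCD]
    refine ContinuousOn.union_of_isClosed (continuousOn_const.congr hθC) (ContinuousOn.congr ?_ hθD)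
      hC hD
    exact ((AddCircle.continuous_mk' (1 : ℝ)).comp u.continuous).continuousOn
  obtain ⟨t₀⟩ : Nonempty T := inferInstance
  obtain ⟨e₀, he₀⟩ := QuotientAddGroup.mk_surjective (θ t₀)
  obtain ⟨Θ, ⟨-, hΘ⟩, -⟩ := (AddCircle.isCoveringMap_coe (1 : ℝ)).existsUnique_continuousMap_lifts
    ⟨θ, hθ⟩ t₀ e₀ he₀
  have hΘ' : ∀ t, ((Θ t : ℝ) : AddCircle (1 : ℝ)) = θ t := fun t => congrFun hΘ t
  have hround : ∀ x : ℝ, (x : AddCircle (1 : ℝ)) = 0 → (round x : ℝ) = x := fun x hx => by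
    obtain ⟨n, hn⟩ := (AddCircle.coe_eq_zero_iff (1 : ℝ)).1 hx
    simp only [zsmul_eq_mul, mul_one] at hn
    rw [← hn, round_intCast]
  have hFC : ∀ t ∈ C, (round (Θ t) : ℝ) = Θ t := fun t ht =>
    hround _ (by rw [hΘ', hθC ht]; rfl)
  have hGD : ∀ t ∈ D, (round (Θ t - u t) : ℝ) = Θ t - u t := fun t ht =>
    hround _ (by rw [AddCircle.coe_sub, hΘ', hθD ht, sub_self])
  refine ⟨fun t => round (Θ t), fun t => round (Θ t - u t),
    continuousOn_round_of_mem_range_intCast Θ.continuous.continuousOn hFC,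
    continuousOn_round_of_mem_range_intCast (Θ.continuous.sub u.continuous).continuousOn hGD,
    fun t ht => ?_, fun t ht => ?_⟩
  · have : u t = 0 := hu₁ ht
    simp [this]
  · have : u t = 1 := hu₂ ht
    simp [this]

end Labelling

/-! ### Cocycles and vanishing homology -/

open Simplicial in
/-- If the first homology of a simplicial set vanishes, every integral `1`-cocycle is additive on
triangles of edges, whether or not they bound a `2`-simplex. -/
lemma SSet.cocycle_add_of_isZero_homology (X : SSet.{u})
    (hX : Limits.IsZero (X.homology (AddCommGrpCat.of (ULift.{u} ℤ)) 1)) (φ : X _⦋1⦌ → ℤ)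
    (hφ : ∀ s : X _⦋2⦌, φ (X.δ 1 s) = φ (X.δ 0 s) + φ (X.δ 2 s)) {a b c : X _⦋1⦌}
    (hab : X.δ 0 a = X.δ 1 b) (hac : X.δ 1 a = X.δ 1 c) (hbc : X.δ 0 b = X.δ 0 c) :
    φ c = φ a + φ b := by
  let R := AddCommGrpCat.of (ULift.{u} ℤ)
  let K := X.chainComplex R
  let Φ : K.X 1 ⟶ R :=
    Limits.Cofan.IsColimit.desc (X.isColimitChainComplexXCofan R 1) fun e => φ e • 𝟙 R
  have hΦ : ∀ e : X _⦋1⦌, X.ιChainComplex e ≫ Φ = φ e • 𝟙 R := fun e =>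
    Limits.Cofan.IsColimit.fac (X.isColimitChainComplexXCofan R 1) _ e
  have hdΦ : K.d 2 1 ≫ Φ = 0 := by
    apply SSet.chainComplex_hom_ext
    intro s
    have hd : X.ιChainComplex s ≫ K.d 2 1 = X.ιChainComplex (R := R) (X.δ 0 s) -
        X.ιChainComplex (X.δ 1 s) + X.ιChainComplex (X.δ 2 s) := by
      refine (SSet.ιChainComplex_d ..).trans ((Fin.sum_univ_three _).trans ?_)
      simp [sub_eq_add_neg]
    rw [← Category.assoc, hd, Preadditive.add_comp, Preadditive.sub_comp, hΦ, hΦ, hΦ, hφ,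
      Limits.comp_zero, add_smul]
    abel
  let k : R ⟶ K.X 1 := X.ιChainComplex a + X.ιChainComplex b - X.ιChainComplex c
  have hk : k ≫ K.d 1 0 = 0 := by
    have hd : ∀ e : X _⦋1⦌, X.ιChainComplex e ≫ K.d 1 0 = X.ιChainComplex (R := R) (X.δ 0 e) -
        X.ιChainComplex (X.δ 1 e) := fun e => by
      refine (SSet.ιChainComplex_d ..).trans ((Fin.sum_univ_two _).trans ?_)
      simp [sub_eq_add_neg]
    simp only [k, Preadditive.add_comp, Preadditive.sub_comp, hd]
    rw [hab, hac, hbc]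
    abel
  -- A cocycle evaluated on a cycle factors through homology, which is zero.
  have h0 : k ≫ Φ = 0 := by
    have h1 : K.liftCycles k 0 (by simp) hk ≫ K.iCycles 1 ≫ K.pOpcycles 1 ≫
        K.descOpcycles Φ 2 (by simp) hdΦ = k ≫ Φ := by simp
    rw [← h1, ← K.homology_π_ι_assoc, hX.eq_of_tgt (K.homologyπ 1) 0]
    simp
  have h2 : (φ a + φ b - φ c) • 𝟙 R = 0 := by
    rw [← h0]
    simp only [k, Preadditive.add_comp, Preadditive.sub_comp, hΦ, add_smul, sub_smul]
  have h3 : (φ a + φ b - φ c) • (1 : ℤ) = 0 := congrArg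
    (fun f : R ⟶ R => (ConcreteCategory.hom f (ULift.up 1 : ULift.{u} ℤ)).down) h2
  rw [smul_eq_mul, mul_one] at h3
  linarith

/-! ### Separation in unicoherent spaces -/

/-- The frontier of a connected component of an open set lies outside that set. -/
lemma IsOpen.frontier_connectedComponentIn_subset {Z : Type*} [TopologicalSpace Z]
    [LocallyConnectedSpace Z] {O : Set Z} (hO : IsOpen O) (x : Z) :
    frontier (connectedComponentIn O x) ⊆ Oᶜ := by
  intro y hy hyO
  have hopen := hO.connectedComponentIn (x := x)
  rw [hopen.frontier_eq] at hy
  obtain ⟨w, hwy, hwx⟩ := mem_closure_iff.1 hy.1 _ (hO.connectedComponentIn (x := y))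
    (mem_connectedComponentIn hyO)
  apply hy.2
  rw [connectedComponentIn_eq hwx, ← connectedComponentIn_eq hwy]
  exact mem_connectedComponentIn hyO

/-- In a connected, locally connected space, removing a connected component of the complement of a
connected set leaves a connected set. -/
lemma isPreconnected_compl_connectedComponentIn_compl {Z : Type*} [TopologicalSpace Z]
    [ConnectedSpace Z] [LocallyConnectedSpace Z] {K : Set Z} (hK : IsPreconnected K)
    (hKc : IsClosed K) {z : Z} (hz : z ∈ K) (z' : Z) :
    IsPreconnected (connectedComponentIn Kᶜ z')ᶜ := by
  set V := connectedComponentIn Kᶜ z'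
  have hVK : K ⊆ Vᶜ := fun y hy hyV => connectedComponentIn_subset _ _ hyV hy
  refine isPreconnected_of_forall z fun y hy => ?_
  by_cases hyK : y ∈ K
  · exact ⟨K, hVK, hz, hyK, hK⟩
  set W := connectedComponentIn Kᶜ y
  have hyW : y ∈ W := mem_connectedComponentIn hyK
  have hfr : frontier W ⊆ K := by
    simpa using hKc.isOpen_compl.frontier_connectedComponentIn_subset y
  obtain ⟨w, hw⟩ : (frontier W).Nonempty := nonempty_frontier_iff.2
    ⟨⟨y, hyW⟩, fun h => connectedComponentIn_subset _ _ (h ▸ Set.mem_univ z : z ∈ W) hz⟩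
  -- Every other component `W` of `Kᶜ` has a frontier point in `K`, so its closure attaches to `K`
  -- without touching `V`.
  refine ⟨closure W ∪ K, Set.union_subset ?_ hVK, .inr hz, .inl (subset_closure hyW),
    isPreconnected_connectedComponentIn.closure.union w (frontier_subset_closure hw) (hfr hw) hK⟩
  rw [closure_eq_self_union_frontier]
  refine Set.union_subset (fun t ht htV => hy ?_) (hfr.trans hVK)
  have : V = W := (connectedComponentIn_eq htV).trans (connectedComponentIn_eq ht).symm
  exact this ▸ hyW

/-- If the intersection of two closed connected sets covering `Z` is always connected, then a closed
set that disconnects two points has a connected component that does. -/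
lemma exists_disconnects_connectedComponentIn {Z : Type*} [TopologicalSpace Z]
    [ConnectedSpace Z] [LocallyPathConnectedSpace Z]
    (huni : ∀ C D : Set Z, IsClosed C → IsClosed D → IsPreconnected C → IsPreconnected D →
      C ∪ D = Set.univ → IsPreconnected (C ∩ D))
    {A : Set Z} {z z' : Z} (hA : IsClosed A) (h : Disconnects A z z') :
    ∃ a ∈ A, Disconnects (connectedComponentIn A a) z z' := by
  by_cases hz : z ∈ A
  · exact ⟨z, hz, fun γ => ⟨0, by simpa using mem_connectedComponentIn hz⟩⟩
  by_cases hz' : z' ∈ A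
  · exact ⟨z', hz', fun γ => ⟨1, by simpa using mem_connectedComponentIn hz'⟩⟩
  set U := connectedComponentIn Aᶜ z
  have hUo : IsOpen U := hA.isOpen_compl.connectedComponentIn
  have hzU : z ∈ U := mem_connectedComponentIn hz
  have hfU : frontier U ⊆ A := by
    simpa using hA.isOpen_compl.frontier_connectedComponentIn_subset z
  have hclU : closure U ⊆ U ∪ A := by
    rw [closure_eq_self_union_frontier]
    exact Set.union_subset_union_right _ hfU
  have hz'U : z' ∉ closure U := fun hcl => by
    rcases hclU hcl with h' | h'
    · have hpc : IsPathConnected U :=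
        (hUo.isConnected_iff_isPathConnected).1 ⟨⟨z, hzU⟩, isPreconnected_connectedComponentIn⟩
      obtain ⟨γ, hγ⟩ := hpc.joinedIn z hzU z' h'
      obtain ⟨t, ht⟩ := h γ
      exact connectedComponentIn_subset _ _ (hγ t) ht
    · exact hz' h'
  -- The frontier of `U` may be disconnected; passing to `V` fills the remaining holes, so that `Vᶜ`
  -- is connected too.
  set V := connectedComponentIn (closure U)ᶜ z'
  have hVo : IsOpen V := isClosed_closure.isOpen_compl.connectedComponentIn
  have hz'V : z' ∈ V := mem_connectedComponentIn hz'U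
  have hVU : ∀ y ∈ V, y ∉ closure U := fun y hy => connectedComponentIn_subset _ _ hy
  have hzV : z ∉ V := fun hzV => hVU z hzV (subset_closure hzU)
  have hfV : frontier V ⊆ closure U := by
    simpa using isClosed_closure.isOpen_compl.frontier_connectedComponentIn_subset z'
  have hfA : frontier V ⊆ A := fun y hy => by
    rcases hclU (hfV hy) with hyU | hyA
    · obtain ⟨w, hwU, hwV⟩ := mem_closure_iff.1 (frontier_subset_closure hy) U hUo hyU
      exact absurd (subset_closure hwU) (hVU w hwV)
    · exact hyA
  have hB : IsPreconnected (frontier V) := by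
    have hcl : frontier V = Vᶜ ∩ closure V := by
      rw [hVo.frontier_eq, Set.sdiff_eq, Set.inter_comm]
    rw [hcl]
    refine huni _ _ hVo.isClosed_compl isClosed_closure ?_
      isPreconnected_connectedComponentIn.closure ?_
    · exact isPreconnected_compl_connectedComponentIn_compl
        isPreconnected_connectedComponentIn.closure isClosed_closure (subset_closure hzU) z'
    · exact Set.eq_univ_of_forall fun y => (em (y ∈ V)).elim (fun h => .inr (subset_closure h)) .inl
  obtain ⟨a, ha⟩ : (frontier V).Nonempty :=
    nonempty_frontier_iff.2 ⟨⟨z', hz'V⟩, fun h => hzV (h ▸ Set.mem_univ z)⟩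
  refine ⟨a, hfA ha, fun γ => ?_⟩
  obtain ⟨t, ht⟩ : (frontier (γ ⁻¹' V)).Nonempty := nonempty_frontier_iff.2
    ⟨⟨1, by simpa using hz'V⟩, fun h => hzV (by simpa using (h ▸ Set.mem_univ 0 : 0 ∈ γ ⁻¹' V))⟩
  exact ⟨t, hB.subset_connectedComponentIn ha hfA (γ.continuous.frontier_preimage_subset V ht)⟩

/-! ### Unicoherence from vanishing first homology -/

section SimplicialHomology

open Simplicial

variable {Z : Type u} [TopologicalSpace Z] {X : SSet.{u}} (ι : X ⟶ TopCat.toSSet.obj (TopCat.of Z))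

/-- The singular simplex of `Z` underlying a simplex of a simplicial set over the singular
simplicial set. -/
noncomputable def singularMap {n : ℕ} (s : X _⦋n⦌) : C(stdSimplex ℝ (Fin (n + 1)), Z) :=
  (TopCat.of Z).toSSetObjEquiv (.op ⦋n⦌) (ι.app _ s)

lemma singularMap_δ {n : ℕ} (s : X _⦋n + 1⦌) (i : Fin (n + 2)) :
    ⇑(singularMap ι (X.δ i s)) = singularMap ι s ∘ stdSimplex.map i.succAbove := by
  have h : ι.app _ (X.δ i s) = (TopCat.toSSet.obj (TopCat.of Z)).δ i (ι.app _ s) :=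
    NatTrans.naturality_apply ι (SimplexCategory.δ i).op s
  funext z
  rw [singularMap, h]
  rfl

instance (n : ℕ) : ContractibleSpace (stdSimplex ℝ (Fin (n + 1))) :=
  (convex_stdSimplex ℝ _).contractibleSpace ⟨_, single_mem_stdSimplex ℝ 0⟩

instance (n : ℕ) : LocallyPathConnectedSpace (stdSimplex ℝ (Fin (n + 1))) :=
  (convex_stdSimplex ℝ _).locallyPathConnectedSpace

/-- Allows incidence of edges in `X` to be checked on endpoints in `Z`. -/
lemma eq_of_singularMap_eq [Mono ι] {x y : X _⦋0⦌}
    (h : singularMap ι x (stdSimplex.vertex 0) = singularMap ι y (stdSimplex.vertex 0)) :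
    x = y := by
  have hinj : Function.Injective (ι.app (.op ⦋0⦌)) :=
    (mono_iff_injective _).1 inferInstance
  refine hinj (((TopCat.of Z).toSSetObjEquiv (.op ⦋0⦌)).injective (ContinuousMap.ext fun t => ?_))
  obtain rfl : t = stdSimplex.vertex 0 := Subsingleton.elim (α := stdSimplex ℝ (Fin 1)) _ _
  exact h

lemma singularMap_δ_vertex {n : ℕ} (s : X _⦋n + 1⦌) (i : Fin (n + 2)) (j : Fin (n + 1)) :
    singularMap ι (X.δ i s) (stdSimplex.vertex j) =
      singularMap ι s (stdSimplex.vertex (i.succAbove j)) := by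
  rw [singularMap_δ, Function.comp, stdSimplex.map_vertex]

/-- Let `X` be a simplicial set of singular simplices of `Z` with vanishing first homology, with
edges joining any two points, and nearby points by edges that stay nearby. Then two closed connected
sets covering `Z` have a connected intersection. -/
theorem isPreconnected_inter_of_isZero_homology [Mono ι]
    (hX : Limits.IsZero (X.homology (AddCommGrpCat.of (ULift.{u} ℤ)) 1))
    (hjoin : ∀ x y : Z, ∃ e : X _⦋1⦌, singularMap ι e (stdSimplex.vertex 0) = x ∧
      singularMap ι e (stdSimplex.vertex 1) = y)
    (hloc : ∀ x : Z, ∀ U ∈ 𝓝 x, ∀ᶠ y in 𝓝 x, ∃ e : X _⦋1⦌,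
      singularMap ι e (stdSimplex.vertex 0) = x ∧
      singularMap ι e (stdSimplex.vertex 1) = y ∧ ∀ t, singularMap ι e t ∈ U)
    {C D : Set Z} (hC : IsClosed C) (hD : IsClosed D) (hCc : IsPreconnected C)
    (hDc : IsPreconnected D) (hCD : C ∪ D = Set.univ) : IsPreconnected (C ∩ D) := by
  rw [isPreconnected_closed_iff]
  rintro P Q hP hQ hPQ ⟨b₁, hb₁⟩ ⟨b₂, hb₂⟩
  by_contra hne
  set B₁ := C ∩ D ∩ P
  set B₂ := C ∩ D ∩ Q
  have hB₁ : IsClosed B₁ := (hC.inter hD).inter hP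
  have hB₂ : IsClosed B₂ := (hC.inter hD).inter hQ
  have hB : C ∩ D = B₁ ∪ B₂ := by
    rw [← Set.inter_union_distrib_left, Set.inter_eq_left.2 hPQ]
  have hd : Disjoint B₁ B₂ := Set.disjoint_left.2 fun y h₁ h₂ => hne ⟨y, h₁.1, h₁.2, h₂.2⟩
  have hex : ∀ {n : ℕ} (s : X _⦋n⦌), ∃ F G, IsLabelling (singularMap ι s ⁻¹' C)
      (singularMap ι s ⁻¹' D) (singularMap ι s ⁻¹' B₁) (singularMap ι s ⁻¹' B₂) F G := fun s => by
    have hs := (singularMap ι s).continuous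
    refine exists_isLabelling (hC.preimage hs) (hD.preimage hs) ?_ ?_ (hB₁.preimage hs)
      (hB₂.preimage hs) (hd.preimage _)
    · rw [← Set.preimage_union, hCD, Set.preimage_univ]
    · rw [← Set.preimage_inter, hB, Set.preimage_union]
  choose F G hFG using fun e : X _⦋1⦌ => hex e
  let φ : X _⦋1⦌ → ℤ := fun e =>
    label (singularMap ι e ⁻¹' C) (F e) (G e) (stdSimplex.vertex 1) -
      label (singularMap ι e ⁻¹' C) (F e) (G e) (stdSimplex.vertex 0)
  have hφ_eq : ∀ (e : X _⦋1⦌) {F' G' : stdSimplex ℝ (Fin 2) → ℤ},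
      IsLabelling (singularMap ι e ⁻¹' C) (singularMap ι e ⁻¹' D) (singularMap ι e ⁻¹' B₁)
        (singularMap ι e ⁻¹' B₂) F' G' →
      φ e = label (singularMap ι e ⁻¹' C) F' G' (stdSimplex.vertex 1) -
        label (singularMap ι e ⁻¹' C) F' G' (stdSimplex.vertex 0) := fun e F' G' h' => by
    have hs := (singularMap ι e).continuous
    refine (hFG e).label_sub_label (hC.preimage hs) (hD.preimage hs) ?_ ?_ h' _ _
    · rw [← Set.preimage_union, hCD, Set.preimage_univ]
    · rw [← Set.preimage_inter, hB, Set.preimage_union]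
  -- One labelling of the triangle restricts to all three edges, so the level changes telescope.
  have hφ_δ : ∀ s : X _⦋2⦌, φ (X.δ 1 s) = φ (X.δ 0 s) + φ (X.δ 2 s) := fun s => by
    obtain ⟨F', G', h'⟩ := hex s
    have key : ∀ i : Fin 3, φ (X.δ i s) =
        label (singularMap ι s ⁻¹' C) F' G' (stdSimplex.vertex (i.succAbove 1)) -
          label (singularMap ι s ⁻¹' C) F' G' (stdSimplex.vertex (i.succAbove 0)) := fun i => by
      have hc : Continuous (stdSimplex.map (S := ℝ) i.succAbove) := stdSimplex.continuous_map _
      have := h'.comp hc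
      simp only [← Set.preimage_comp, ← singularMap_δ] at this
      rw [hφ_eq _ this, singularMap_δ, Set.preimage_comp, label_comp, label_comp,
        stdSimplex.map_vertex, stdSimplex.map_vertex]
    rw [key, key, key]
    simp [Fin.succAbove]
  have hadd : ∀ a b c : X _⦋1⦌,
      singularMap ι a (stdSimplex.vertex 1) = singularMap ι b (stdSimplex.vertex 0) →
      singularMap ι a (stdSimplex.vertex 0) = singularMap ι c (stdSimplex.vertex 0) →
      singularMap ι b (stdSimplex.vertex 1) = singularMap ι c (stdSimplex.vertex 1) →
      φ c = φ a + φ b := fun a b c hab hac hbc =>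
    X.cocycle_add_of_isZero_homology hX φ hφ_δ
      (eq_of_singularMap_eq ι (by rw [singularMap_δ_vertex, singularMap_δ_vertex]; exact hab))
      (eq_of_singularMap_eq ι (by rw [singularMap_δ_vertex, singularMap_δ_vertex]; exact hac))
      (eq_of_singularMap_eq ι (by rw [singularMap_δ_vertex, singularMap_δ_vertex]; exact hbc))
  choose p hp₀ hp₁ using hjoin b₁
  have hnear₁ : ∀ x ∉ B₂, ∀ᶠ y in 𝓝 x, φ (p y) = φ (p x) := fun x hx => by
    filter_upwards [hloc x B₂ᶜ (hB₂.isOpen_compl.mem_nhds hx)] with y ⟨e, h₀, h₁, he⟩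
    rw [hadd (p x) e (p y) ((hp₁ x).trans h₀.symm) ((hp₀ x).trans (hp₀ y).symm)
      (h₁.trans (hp₁ y).symm)]
    -- An edge missing `B₂` sees no jump, so zero labels are admissible.
    have hl : IsLabelling (singularMap ι e ⁻¹' C) (singularMap ι e ⁻¹' D) (singularMap ι e ⁻¹' B₁)
        (singularMap ι e ⁻¹' B₂) (fun _ => 0) (fun _ => 0) :=
      ⟨continuousOn_const, continuousOn_const, fun _ _ => rfl, fun t ht => absurd ht (he t)⟩
    rw [hφ_eq e hl]
    simp [label]
  have hnear₂ : ∀ x ∈ B₂, ∀ᶠ y in 𝓝 x, y ∉ B₁ ∧ (y ∈ C → φ (p y) = φ (p x)) ∧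
      (y ∉ C → φ (p y) = φ (p x) - 1) := fun x hx => by
    have hx₁ : x ∉ B₁ := Set.disjoint_right.1 hd hx
    filter_upwards [hloc x B₁ᶜ (hB₁.isOpen_compl.mem_nhds hx₁), hB₁.isOpen_compl.mem_nhds hx₁]
      with y ⟨e, h₀, h₁, he⟩ hy
    rw [hadd (p x) e (p y) ((hp₁ x).trans h₀.symm) ((hp₀ x).trans (hp₀ y).symm)
      (h₁.trans (hp₁ y).symm)]
    have hl : IsLabelling (singularMap ι e ⁻¹' C) (singularMap ι e ⁻¹' D) (singularMap ι e ⁻¹' B₁)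
        (singularMap ι e ⁻¹' B₂) (fun _ => 0) (fun _ => -1) :=
      ⟨continuousOn_const, continuousOn_const, fun t ht => absurd ht (he t), fun _ _ => by simp⟩
    rw [hφ_eq e hl, label_of_mem (t := stdSimplex.vertex 0) (by simpa [h₀] using hx.1.1)]
    refine ⟨hy, fun hyC => ?_, fun hyC => ?_⟩
    · rw [label_of_mem (by simpa [h₁] using hyC)]
      simp
    · rw [label_of_notMem (by simpa [h₁] using hyC)]
      simp [sub_eq_add_neg]
  have hFC : ContinuousOn (fun x => φ (p x)) C := fun x hx => by
    refine (Filter.tendsto_pure.2 ?_).mono_right (pure_le_nhds _)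
    by_cases hxB : x ∈ B₂
    · filter_upwards [nhdsWithin_le_nhds (hnear₂ x hxB), self_mem_nhdsWithin] with y hy hyC
        using hy.2.1 hyC
    · exact nhdsWithin_le_nhds (hnear₁ x hxB)
  classical
  -- `label` reads points of `B₂` in `C`; subtracting 1 there gives the reading in `D`.
  have hGD : ContinuousOn (fun x => if x ∈ B₂ then φ (p x) - 1 else φ (p x)) D := fun x hx => by
    refine (Filter.tendsto_pure.2 ?_).mono_right (pure_le_nhds _)
    by_cases hxB : x ∈ B₂
    · filter_upwards [nhdsWithin_le_nhds (hnear₂ x hxB), self_mem_nhdsWithin] with y hy hyD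
      by_cases hyC : y ∈ C
      · have hyB : y ∈ B₂ := (hB.subset ⟨hyC, hyD⟩).resolve_left hy.1
        simp [hxB, hyB, hy.2.1 hyC]
      · have hyB : y ∉ B₂ := fun h => hyC h.1.1
        simp [hxB, hyB, hy.2.2 hyC]
    · filter_upwards [nhdsWithin_le_nhds (hnear₁ x hxB),
        nhdsWithin_le_nhds (hB₂.isOpen_compl.mem_nhds hxB)] with y hy hyB
      rw [if_neg hxB, if_neg hyB, hy]
  have h₁ := hCc.constant_of_mapsTo (T := Set.univ) (isDiscrete_univ_iff.2 inferInstance) hFC (Set.mapsTo_univ _ _) hb₁.1.1 hb₂.1.1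
  have h₂ := hDc.constant_of_mapsTo (T := Set.univ) (isDiscrete_univ_iff.2 inferInstance) hGD (Set.mapsTo_univ _ _) hb₁.1.2 hb₂.1.2
  have hb₁' : b₁ ∉ B₂ := Set.disjoint_left.1 hd hb₁
  have hb₂' : b₂ ∈ B₂ := hb₂
  simp only [if_neg hb₁', if_pos hb₂'] at h₂
  linarith

end SimplicialHomology

/-! ### Lipschitz curves -/

/-- A path reparametrized by the standard `1`-simplex. -/
noncomputable def Path.toStdSimplex {Z : Type*} [TopologicalSpace Z] {x y : Z} (γ : Path x y) :
    C(stdSimplex ℝ (Fin 2), Z) :=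
  ⟨γ ∘ stdSimplexHomeomorphUnitInterval, γ.continuous.comp (Homeomorph.continuous _)⟩

lemma Path.toStdSimplex_vertex_zero {Z : Type*} [TopologicalSpace Z] {x y : Z} (γ : Path x y) :
    γ.toStdSimplex (stdSimplex.vertex 0) = x :=
  (congrArg γ stdSimplexHomeomorphUnitInterval_zero).trans γ.source

lemma Path.toStdSimplex_vertex_one {Z : Type*} [TopologicalSpace Z] {x y : Z} (γ : Path x y) :
    γ.toStdSimplex (stdSimplex.vertex 1) = y :=
  (congrArg γ stdSimplexHomeomorphUnitInterval_one).trans γ.target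

lemma LipschitzWith.path_toStdSimplex {Z : Type*} [MetricSpace Z] {x y : Z} {γ : Path x y}
    {K : NNReal} (h : LipschitzWith K γ) : LipschitzWith K γ.toStdSimplex := by
  have h₁ : LipschitzWith 1 stdSimplexHomeomorphUnitInterval :=
    LipschitzWith.of_dist_le_mul fun s t => by
      rw [NNReal.coe_one, one_mul]
      exact dist_le_pi_dist (s : Fin 2 → ℝ) t 1
  exact (mul_one K) ▸ h.comp h₁

lemma LipschitzWith.path_extend {Z : Type*} [MetricSpace Z] {x y : Z} {γ : Path x y} {K : NNReal}
    (h : LipschitzWith K γ) : LipschitzWith K γ.extend := by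
  exact (mul_one K) ▸ h.comp (LipschitzWith.projIcc zero_le_one)

/-- Each half is run at double speed, whence the factor 2; points in different halves are compared
through `y`. -/
lemma LipschitzWith.path_trans {Z : Type*} [MetricSpace Z] {x y z : Z} {γ : Path x y}
    {γ' : Path y z} {K : NNReal} (h : LipschitzWith K γ) (h' : LipschitzWith K γ') :
    LipschitzWith (K * 2) (γ.trans γ') := by
  have he : ∀ a b : ℝ, a ≤ b → dist (γ.extend a) (γ.extend b) ≤ K * (b - a) := fun a b hab => by
    simpa [Real.dist_eq, abs_sub_comm a b, abs_of_nonneg (sub_nonneg.2 hab)]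
      using h.path_extend.dist_le_mul a b
  have he' : ∀ a b : ℝ, a ≤ b → dist (γ'.extend a) (γ'.extend b) ≤ K * (b - a) := fun a b hab => by
    simpa [Real.dist_eq, abs_sub_comm a b, abs_of_nonneg (sub_nonneg.2 hab)]
      using h'.path_extend.dist_le_mul a b
  have key : ∀ s t : unitInterval, (s : ℝ) ≤ t →
      dist (γ.trans γ' s) (γ.trans γ' t) ≤ (K * 2 : ℝ) * (t - s) := fun s t hst => by
    rw [← Path.extend_apply _ s.2, ← Path.extend_apply _ t.2]
    rcases le_total (t : ℝ) (1 / 2) with ht | ht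
    · rw [Path.extend_trans_of_le_half _ _ ht, Path.extend_trans_of_le_half _ _ (hst.trans ht)]
      exact (he _ _ (by linarith)).trans_eq (by ring)
    rw [Path.extend_trans_of_half_le _ _ ht]
    rcases le_total (1 / 2) (s : ℝ) with hs | hs
    · rw [Path.extend_trans_of_half_le _ _ hs]
      exact (he' _ _ (by linarith)).trans_eq (by ring)
    · rw [Path.extend_trans_of_le_half _ _ hs]
      have h₁ := he (2 * s) 1 (by linarith)
      have h₂ := he' 0 (2 * t - 1) (by linarith)
      rw [Path.extend_one] at h₁
      rw [Path.extend_zero] at h₂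
      linarith [dist_triangle (γ.extend (2 * s)) y (γ'.extend (2 * t - 1))]
  refine LipschitzWith.of_dist_le_mul fun s t => ?_
  rw [Subtype.dist_eq, Real.dist_eq]
  push_cast
  rcases le_total (s : ℝ) t with hst | hst
  · rw [abs_sub_comm, abs_of_nonneg (sub_nonneg.2 hst)]
    exact key s t hst
  · rw [dist_comm, abs_of_nonneg (sub_nonneg.2 hst)]
    exact key t s hst

lemma IsLocallyLipschitzPathConnected.locallyPathConnectedSpace {Z : Type*} [MetricSpace Z]
    (h : IsLocallyLipschitzPathConnected Z) : LocallyPathConnectedSpace Z :=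
  .of_bases h fun _ S hS => by
    obtain ⟨x, hx⟩ := hS.2.1
    refine ⟨x, hx, fun {y} hy => ?_⟩
    obtain ⟨γ, -, -, hγ⟩ := hS.2.2 x hx y hy
    exact ⟨γ, hγ⟩

lemma IsLocallyLipschitzPathConnected.exists_lipschitzWith_path {Z : Type*} [MetricSpace Z]
    [PreconnectedSpace Z] (h : IsLocallyLipschitzPathConnected Z) (x y : Z) :
    ∃ (γ : Path x y) (K : NNReal), LipschitzWith K γ := by
  -- Being joined by a Lipschitz curve is transitive and holds locally, so connectedness makes it
  -- global.
  refine PreconnectedSpace.induction₂' (fun x y => ∃ (γ : Path x y) (K : NNReal), LipschitzWith K γ)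
    (fun x => ?_) ⟨?_⟩ x y
  · obtain ⟨S, hS, -⟩ := (h x).mem_iff.1 Filter.univ_mem
    filter_upwards [hS.1] with y hy
    have hx := mem_of_mem_nhds hS.1
    obtain ⟨γ, K, hK, -⟩ := hS.2.2 x hx y hy
    obtain ⟨γ', K', hK', -⟩ := hS.2.2 y hy x hx
    exact ⟨⟨γ, K, hK⟩, ⟨γ', K', hK'⟩⟩
  · rintro a b c ⟨γ, K, hK⟩ ⟨γ', K', hK'⟩
    exact ⟨γ.trans γ', _, (hK.weaken (le_max_left K K')).path_trans (hK'.weaken (le_max_right K K'))⟩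

theorem mainTheorem9 :
    (∀ (Z : Type u) [TopologicalSpace Z] [ConnectedSpace Z] [LocallyPathConnectedSpace Z],
      Limits.IsZero (singularH 1 Z) →
      ∀ (A : Set Z) (z z' : Z), IsClosed A → Disconnects A z z' →
        ∃ a ∈ A, Disconnects (connectedComponentIn A a) z z') ∧
    (∀ (Z : Type u) [MetricSpace Z] [ConnectedSpace Z],
      IsLocallyLipschitzPathConnected Z →
      Limits.IsZero (lipschitzH 1 Z) →
      ∀ (A : Set Z) (z z' : Z), IsClosed A → Disconnects A z z' →
        ∃ a ∈ A, Disconnects (connectedComponentIn A a) z z') := by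
  refine ⟨fun Z _ _ _ hZ A z z' hA h => ?_, fun Z _ _ hloc hZ A z z' hA h => ?_⟩
  · refine exists_disconnects_connectedComponentIn (fun C D hC hD hCc hDc hCD => ?_) hA h
    have hlift : ∀ {x y : Z} (γ : Path x y),
        ∃ e, singularMap (𝟙 (TopCat.toSSet.obj (TopCat.of Z))) e = γ.toStdSimplex := fun γ =>
      ⟨((TopCat.of Z).toSSetObjEquiv (.op (.mk 1))).symm γ.toStdSimplex,
        Equiv.apply_symm_apply _ _⟩
    refine isPreconnected_inter_of_isZero_homology (𝟙 (TopCat.toSSet.obj (TopCat.of Z))) hZ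
      (fun x y => ?_) (fun x U hU => ?_) hC hD hCc hDc hCD
    · have : PathConnectedSpace Z := pathConnectedSpace_iff_connectedSpace.2 inferInstance
      obtain ⟨e, he⟩ := hlift (PathConnectedSpace.somePath x y)
      exact ⟨e, he ▸ Path.toStdSimplex_vertex_zero _, he ▸ Path.toStdSimplex_vertex_one _⟩
    · obtain ⟨S, ⟨hSx, hS⟩, hSU⟩ := (path_connected_basis x).mem_iff.1 hU
      filter_upwards [hSx] with y hy
      obtain ⟨γ, hγ⟩ := hS.joinedIn x (mem_of_mem_nhds hSx) y hy
      obtain ⟨e, he⟩ := hlift γ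
      exact ⟨e, he ▸ γ.toStdSimplex_vertex_zero, he ▸ γ.toStdSimplex_vertex_one,
        fun t => he ▸ hSU (hγ _)⟩
  · have := hloc.locallyPathConnectedSpace
    refine exists_disconnects_connectedComponentIn (fun C D hC hD hCc hDc hCD => ?_) hA h
    have hlift : ∀ {x y : Z} (γ : Path x y) {K : NNReal}, LipschitzWith K γ →
        ∃ e, singularMap (lipschitzSingularSet Z).ι e = γ.toStdSimplex := fun γ K hγ =>
      ⟨⟨((TopCat.of Z).toSSetObjEquiv (.op (.mk 1))).symm γ.toStdSimplex, K,
        hγ.path_toStdSimplex⟩, Equiv.apply_symm_apply _ _⟩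
    refine isPreconnected_inter_of_isZero_homology (lipschitzSingularSet Z).ι hZ
      (fun x y => ?_) (fun x U hU => ?_) hC hD hCc hDc hCD
    · obtain ⟨γ, K, hγ⟩ := hloc.exists_lipschitzWith_path x y
      obtain ⟨e, he⟩ := hlift γ hγ
      exact ⟨e, he ▸ γ.toStdSimplex_vertex_zero, he ▸ γ.toStdSimplex_vertex_one⟩
    · obtain ⟨S, ⟨hSx, hS⟩, hSU⟩ := (hloc x).mem_iff.1 hU
      filter_upwards [hSx] with y hy
      obtain ⟨γ, K, hγ, hγS⟩ := hS.2 x (mem_of_mem_nhds hSx) y hy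
      obtain ⟨e, he⟩ := hlift γ hγ
      exact ⟨e, he ▸ γ.toStdSimplex_vertex_zero, he ▸ γ.toStdSimplex_vertex_one,
        fun t => he ▸ hSU (hγS _)⟩
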